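/- Let $d\ge 0$ be an integer, equip $\mathbb{R}^d$ with the norm $\|\cdot\|=\|\cdot\|_\infty$, and let $h:\mathbb{R}^d\to\mathbb{R}^d$ satisfy the Borkar–Meyn assumption, that is: (i) $h$ is Lipschitz continuous: there is $L_h\ge 0$ with $\|h(x)-h(y)\|\le L_h\|x-y\|$ for all $x,y\in\mathbb{R}^d$; (ii) there is a function $h_\infty:\mathbb{R}^d\to\mathbb{R}^d$ such that the functions $h_c(x):=h(cx)/c$, $c\ge 1$, converge to $h_\infty$ uniformly on compact sets as $c\uparrow\infty$; (iii) the ODE $\dot x(t)=h_\infty(x(t))$ has the origin as its unique globally asymptotically stable equilibrium. Then the equilibrium set $E_h:=\{x\in\mathbb{R}^d : h(x)=0\}$ is nonempty and compact, and it is contained in some compact, connected, globally asymptotically stable set of the ODE $\dot x(t)=h(x(t))$. Here a set $M\subset\mathbb{R}^d$ is called globally asymptotically stable for an ODE $\dot x(t)=g(x(t))$ if it is Lyapunov stable (for every $\epsilon>0$ there is $\delta>0$ such that every solution $x(\cdot)$ on $[0,\infty)$ whose initial point $x(0)$ is at distance less than $\delta$ from $M$ satisfies $\operatorname{dist}(x(t),M)<\epsilon$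 for all $t\ge 0$) and globally attracting (every solution $x(\cdot)$ on $[0,\infty)$ satisfies $\operatorname{dist}(x(t),M)\to 0$ as $t\to\infty$), where the distance to the empty set is $+\infty$; a point $p$ is a globally asymptotically stable equilibrium if $g(p)=0$ and $\{p\}$ is globally asymptotically stable. -/

import Mathlib

open Set Filter Topology

namespace BorkarMeyn

/-- `x` is a forward solution, on `[0, ∞)`, of the autonomous ODE `ẋ(t) = h (x(t))`
(with the one-sided derivative at `t = 0`; values at negative times are irrelevant). -/
def IsForwardSolution {d : ℕ} (h : (Fin d → ℝ) → Fin d → ℝ)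
    (x : ℝ → (Fin d → ℝ)) : Prop :=
  ∀ t : ℝ, 0 ≤ t → HasDerivWithinAt x (h (x t)) (Ici 0) t

/-- Lyapunov stability of the set `M` for `ẋ = h(x)`: solutions that start close enough to `M`
stay in a prescribed neighbourhood of `M` for all `t ≥ 0`.
(`Metric.thickening ε M` is the set of points at distance less than `ε` from `M`.) -/
def IsLyapunovStable {d : ℕ} (h : (Fin d → ℝ) → Fin d → ℝ)
    (M : Set (Fin d → ℝ)) : Prop :=
  ∀ ε : ℝ, 0 < ε → ∃ δ : ℝ, 0 < δ ∧
    ∀ x : ℝ → (Fin d → ℝ), IsForwardSolution h x →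
      x 0 ∈ Metric.thickening δ M → ∀ t : ℝ, 0 ≤ t → x t ∈ Metric.thickening ε M

/-- Global attraction: for every initial condition, the distance from `x(t)` to `M` tends
to `0` as `t → ∞`. -/
def IsGloballyAttracting {d : ℕ} (h : (Fin d → ℝ) → Fin d → ℝ)
    (M : Set (Fin d → ℝ)) : Prop :=
  ∀ x : ℝ → (Fin d → ℝ), IsForwardSolution h x →
    ∀ ε : ℝ, 0 < ε → ∀ᶠ t in atTop, x t ∈ Metric.thickening ε M

/-- `M` is globally asymptotically stable for `ẋ = h(x)`. -/
def IsGloballyAsymptoticallyStable {d : ℕ}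
    (h : (Fin d → ℝ) → Fin d → ℝ)
    (M : Set (Fin d → ℝ)) : Prop :=
  IsLyapunovStable h M ∧ IsGloballyAttracting h M

/-- The equilibrium set `{x | h(x) = 0}` of `ẋ = h(x)`. -/
def equilibriumSet {d : ℕ} (h : (Fin d → ℝ) → Fin d → ℝ) :
    Set (Fin d → ℝ) :=
  {x | h x = 0}

/-- `p` is a globally asymptotically stable equilibrium of `ẋ = h(x)`. -/
def IsGASEquilibrium {d : ℕ} (h : (Fin d → ℝ) → Fin d → ℝ)
    (p : (Fin d → ℝ)) : Prop :=
  p ∈ equilibriumSet h ∧ IsGloballyAsymptoticallyStable h {p}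

/-- The Borkar–Meyn assumption on `h`: `h` is Lipschitz; the rescalings `h_c(x) = h(cx)/c`
converge, as `c → ∞`, uniformly on compact sets to some `hInf`; and the ODE `ẋ = hInf(x)` has
the origin as its unique globally asymptotically stable equilibrium. -/
def Assumption {d : ℕ} (h : (Fin d → ℝ) → Fin d → ℝ) : Prop :=
  (∃ L : ℝ, 0 ≤ L ∧ ∀ x y, ‖h x - h y‖ ≤ L * ‖x - y‖) ∧
  ∃ hInf : (Fin d → ℝ) → (Fin d → ℝ),
    (∀ K : Set (Fin d → ℝ), IsCompact K →
      TendstoUniformlyOn (fun (c : ℝ) x => c⁻¹ • h (c • x)) hInf atTop K) ∧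
    IsGASEquilibrium hInf 0 ∧ ∀ p, IsGASEquilibrium hInf p → p = 0

end BorkarMeyn

/-! The scaling limit `hInf` is Lipschitz and positively homogeneous. By homogeneity and compactness
of the unit ball, asymptotic stability of the origin becomes uniform: some time `T` of its flow `φ`
halves every norm. Hence `V x = sup_{0 ≤ t ≤ T} exp (l t) ‖φ t x‖`, with `exp (l T) = 2`, is a
Lipschitz, subhomogeneous Lyapunov function dominating the norm and decaying exponentially
(`exists_lyapunov`). Since `h - hInf` is sublinear at infinity, Grönwall's inequality shows that `V`
also drops at unit speed along `ẋ = h(x)` wherever `V ≥ r` (`exists_lyapunov_decrease`).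

The required set is `{V ≤ r}`: it is compact, star-shaped, forward invariant and attracting, and it
contains every equilibrium because constant solutions are attracted too.

For existence of an equilibrium, Brouwer's theorem gives each time-`t` map a fixed point in `{V ≤
r}`. A solution returning after a short time `t` has speed `O(t)` at its start, so `‖h‖` has minimum
zero there.

Brouwer's theorem for Lipschitz maps comes from a volume argument. If `u` is Lipschitz and vanishes
off a bounded open `U`, then `x + t u(x)` permutes `U` for small `t`, so `∫ det (1 + t Du)` over `U`
is the volume of `U`. Being polynomial in `t`, the integral has this value at `t = 1` as well, which
excludes a map sending a ball into its sphere and fixing the outside: its derivative would be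
singular almost everywhere. -/

namespace BorkarMeyn

/-! ### Global forward existence for Lipschitz vector fields -/

section ODE

variable {E : Type*} [NormedAddCommGroup E] [NormedSpace ℝ E]

/-- Two solutions on adjacent intervals, the second one started at the end point of the first,
can be concatenated. -/
theorem exists_solution_Icc_add {v : E → E} {a b : ℝ} (ha : 0 ≤ a) (hb : 0 ≤ b)
    (hva : ∀ x₀ : E, ∃ x : ℝ → E, x 0 = x₀ ∧
      ∀ t ∈ Icc 0 a, HasDerivWithinAt x (v (x t)) (Icc 0 a) t)
    (hvb : ∀ x₀ : E, ∃ x : ℝ → E, x 0 = x₀ ∧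
      ∀ t ∈ Icc 0 b, HasDerivWithinAt x (v (x t)) (Icc 0 b) t) (x₀ : E) :
    ∃ x : ℝ → E, x 0 = x₀ ∧
      ∀ t ∈ Icc 0 (a + b), HasDerivWithinAt x (v (x t)) (Icc 0 (a + b)) t := by
  obtain ⟨x, hx0, hx⟩ := hva x₀
  obtain ⟨y, hy0, hy⟩ := hvb (x a)
  set z : ℝ → E := fun t => if t ≤ a then x t else y (t - a) with hz
  have hzx : ∀ t ∈ Icc 0 a, z t = x t := fun t ht => by simp [hz, ht.2]
  have hzy : ∀ t ∈ Icc a (a + b), z t = y (t - a) := by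
    intro t ht
    rcases ht.1.eq_or_lt with h | h
    · simp [hz, ← h, hy0]
    · simp [hz, not_le.2 h]
  -- Off the closed piece the derivative within it is vacuous, so both pieces can be treated at
  -- every `t` and glued as a union.
  have h1 : ∀ t, t ∈ Icc 0 (a + b) → HasDerivWithinAt z (v (z t)) (Icc 0 a) t := by
    intro t _
    by_cases ht : t ∈ Icc 0 a
    · rw [hzx t ht]
      exact (hx t ht).congr hzx (hzx t ht)
    · exact HasFDerivWithinAt.of_notMem_closure (by rwa [isClosed_Icc.closure_eq])
  have h2 : ∀ t, t ∈ Icc 0 (a + b) → HasDerivWithinAt z (v (z t)) (Icc a (a + b)) t := by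
    intro t _
    by_cases ht : t ∈ Icc a (a + b)
    · rw [hzy t ht]
      refine HasDerivWithinAt.congr ?_ hzy (hzy t ht)
      have := (hy (t - a) ⟨by linarith [ht.1], by linarith [ht.2]⟩).scomp (h := fun s => s - a)
        (s := Icc a (a + b)) t ((hasDerivAt_id t).sub_const a).hasDerivWithinAt
        (fun s hs => ⟨by linarith [hs.1], by linarith [hs.2]⟩)
      simpa [Function.comp_def] using this
    · exact HasFDerivWithinAt.of_notMem_closure (by rwa [isClosed_Icc.closure_eq])
  refine ⟨z, by rw [hzx 0 ⟨le_rfl, ha⟩, hx0], fun t ht => ?_⟩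
  rw [← Icc_union_Icc_eq_Icc ha (by linarith : a ≤ a + b)]
  exact (h1 t ht).union (h2 t ht)

variable [CompleteSpace E]

/-- Local solutions of an ODE with Lipschitz right-hand side exist for a uniform time. -/
theorem exists_solution_Icc_step {v : E → E} {K : NNReal} (hv : LipschitzWith K v) (x₀ : E) :
    ∃ x : ℝ → E, x 0 = x₀ ∧ ∀ t ∈ Icc (0 : ℝ) (1 / (K + 1)),
      HasDerivWithinAt x (v (x t)) (Icc 0 (1 / (K + 1))) t := by
  have hpos : (0 : ℝ) ≤ 1 / (K + 1) := by positivity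
  -- On the ball of radius `‖v x₀‖` the speed is at most `(K + 1) ‖v x₀‖`, so the exit time `1 / (K
  -- + 1)` does not depend on `x₀`.
  have hP : IsPicardLindelof (fun _ => v) (⟨0, le_rfl, hpos⟩ : Icc (0 : ℝ) (1 / (K + 1))) x₀
      ‖v x₀‖₊ 0 (‖v x₀‖₊ * (K + 1)) K := by
    refine IsPicardLindelof.of_time_independent (fun x hx => ?_) hv.lipschitzOnWith ?_
    · have h1 := hv.dist_le_mul x x₀
      rw [dist_eq_norm, dist_eq_norm] at h1
      have h2 : ‖x - x₀‖ ≤ ‖v x₀‖ := by simpa [dist_eq_norm] using hx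
      have h3 : ‖v x‖ ≤ ‖v x - v x₀‖ + ‖v x₀‖ := by
        simpa using norm_add_le (v x - v x₀) (v x₀)
      have h4 : (K : ℝ) * ‖x - x₀‖ ≤ K * ‖v x₀‖ := by gcongr
      push_cast
      linarith
    · have : max ((1 : ℝ) / (K + 1) - 0) (0 - 0) = 1 / (K + 1) := by simpa using hpos
      simp only [this]
      push_cast
      field_simp
      simp
  exact hP.exists_eq_forall_mem_Icc_hasDerivWithinAt₀

/-- Solutions of an ODE with Lipschitz right-hand side exist on all bounded intervals. -/
theorem exists_solution_Icc {v : E → E} {K : NNReal} (hv : LipschitzWith K v) (n : ℕ) (x₀ : E) :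
    ∃ x : ℝ → E, x 0 = x₀ ∧ ∀ t ∈ Icc (0 : ℝ) n, HasDerivWithinAt x (v (x t)) (Icc 0 (n : ℝ)) t := by
  have key : ∀ m : ℕ, ∀ x₀ : E, ∃ x : ℝ → E, x 0 = x₀ ∧ ∀ t ∈ Icc (0 : ℝ) (m * (1 / (K + 1))),
      HasDerivWithinAt x (v (x t)) (Icc 0 (m * (1 / (K + 1)))) t := by
    intro m
    induction m with
    | zero =>
      intro x₀
      refine ⟨fun t => x₀ + t • v x₀, by simp, fun t ht => ?_⟩
      obtain rfl : t = 0 := le_antisymm (by simpa using ht.2) ht.1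
      simpa using (((hasDerivAt_id (0 : ℝ)).smul_const (v x₀)).const_add x₀).hasDerivWithinAt
    | succ m ih =>
      intro x₀
      have := exists_solution_Icc_add (by positivity) (by positivity) ih
        (exists_solution_Icc_step hv) x₀
      simpa only [Nat.cast_succ, add_mul, one_mul] using this
  obtain ⟨m, hm⟩ := exists_nat_ge ((n : ℝ) * (K + 1))
  obtain ⟨x, hx0, hx⟩ := key m x₀
  have hle : (n : ℝ) ≤ m * (1 / (K + 1)) := by
    rw [mul_one_div, le_div_iff₀ (by positivity)]
    exact hm
  exact ⟨x, hx0, fun t ht => (hx t ⟨ht.1, ht.2.trans hle⟩).mono (Icc_subset_Icc_right hle)⟩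

/-- Global forward existence for ODEs with Lipschitz right-hand side. -/
theorem exists_solution_Ici {v : E → E} {K : NNReal} (hv : LipschitzWith K v) (x₀ : E) :
    ∃ x : ℝ → E, x 0 = x₀ ∧ ∀ t : ℝ, 0 ≤ t → HasDerivWithinAt x (v (x t)) (Ici 0) t := by
  choose x hx0 hx using fun n : ℕ => exists_solution_Icc hv n x₀
  have hright : ∀ n : ℕ, ∀ m ≤ n, ∀ t ∈ Ico (0 : ℝ) m,
      HasDerivWithinAt (x n) (v (x n t)) (Ici t) t := by
    intro n m hmn t ht
    have hmn' : (m : ℝ) ≤ n := by exact_mod_cast hmn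
    refine (hx n t ⟨ht.1, ht.2.le.trans hmn'⟩).mono_of_mem_nhdsWithin ?_
    exact mem_of_superset (Icc_mem_nhdsGE (ht.2.trans_le hmn')) (Icc_subset_Icc_left ht.1)
  have hcont : ∀ n : ℕ, ∀ m ≤ n, ContinuousOn (x n) (Icc (0 : ℝ) m) := fun n m hmn t ht =>
    (hx n t ⟨ht.1, ht.2.trans (by exact_mod_cast hmn)⟩).continuousWithinAt.mono
      (Icc_subset_Icc_right (by exact_mod_cast hmn))
  have hagree : ∀ m n : ℕ, m ≤ n → EqOn (x m) (x n) (Icc (0 : ℝ) m) := by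
    intro m n hmn
    refine ODE_solution_unique (v := fun _ => v) (K := K) (fun _ => hv) (hcont m m le_rfl)
      (hright m m le_rfl) (hcont n m hmn) (hright n m hmn) ?_
    rw [hx0, hx0]
  set z : ℝ → E := fun t => x (⌈t⌉₊) t with hz
  have hzx : ∀ n : ℕ, ∀ t ∈ Icc (0 : ℝ) n, z t = x n t := fun n t ht =>
    hagree _ n (Nat.ceil_le.2 ht.2) ⟨ht.1, Nat.le_ceil t⟩
  refine ⟨z, by simp [hz, hx0], fun t ht => ?_⟩
  obtain ⟨n, hn⟩ := exists_nat_gt t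
  have hd : HasDerivWithinAt z (v (z t)) (Icc 0 (n : ℝ)) t := by
    rw [hzx n t ⟨ht, hn.le⟩]
    exact (hx n t ⟨ht, hn.le⟩).congr (hzx n) (hzx n t ⟨ht, hn.le⟩)
  refine hd.mono_of_mem_nhdsWithin ?_
  rw [← Ici_inter_Iic]
  exact inter_mem self_mem_nhdsWithin (mem_nhdsWithin_of_mem_nhds (Iic_mem_nhds hn))

end ODE

end BorkarMeyn

namespace BorkarMeyn

/-! ### Volume invariance under Lipschitz perturbations of the identity -/

section Brouwer

open MeasureTheory Polynomial

/-- Extrapolation: the value at `1` of a polynomial of bounded degree is a fixed linear combination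
of its values at finitely many points of `(0, δ)`. -/
theorem exists_extrapolation (n : ℕ) {δ : ℝ} (hδ : 0 < δ) :
    ∃ a w : ℕ → ℝ, (∀ i, a i ∈ Ioo 0 δ) ∧ ∀ p : ℝ[X], p.natDegree ≤ n →
      p.eval 1 = ∑ i ∈ Finset.range (n + 1), w i * p.eval (a i) := by
  set a : ℕ → ℝ := fun i => δ / (i + 2) with ha
  have hinj : Set.InjOn a (Finset.range (n + 1)) := by
    intro i _ j _ hij
    have hi : (0 : ℝ) < i + 2 := by positivity
    have hj : (0 : ℝ) < j + 2 := by positivity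
    simp only [ha] at hij
    rw [div_eq_div_iff hi.ne' hj.ne'] at hij
    have := mul_left_cancel₀ hδ.ne' hij
    exact_mod_cast (by linarith : (i : ℝ) = j)
  refine ⟨a, fun i => (Lagrange.basis (Finset.range (n + 1)) a i).eval 1, fun i => ⟨by positivity, ?_⟩,
    fun p hp => ?_⟩
  · rw [div_lt_iff₀ (by positivity)]
    nlinarith [(Nat.cast_nonneg i : (0 : ℝ) ≤ i)]
  · have hdeg : p.degree < (Finset.range (n + 1)).card := by
      rw [Finset.card_range]
      exact lt_of_le_of_lt degree_le_natDegree (by exact_mod_cast Nat.lt_succ_of_le hp)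
    conv_lhs => rw [Lagrange.eq_interpolate hinj hdeg, Lagrange.interpolate_apply]
    simp [eval_finsetSum, mul_comm]

variable {E : Type*} [NormedAddCommGroup E] [NormedSpace ℝ E] [FiniteDimensional ℝ E]

/-- `det (1 + t A)` is a polynomial in `t`. -/
theorem exists_polynomial_det_one_add_smul (A : E →L[ℝ] E) :
    ∃ p : ℝ[X], p.natDegree ≤ Module.finrank ℝ E ∧ ∀ t : ℝ, p.eval t = (1 + t • A).det := by
  set b := Module.finBasis ℝ E
  set M := LinearMap.toMatrix b b (A : E →ₗ[ℝ] E) with hM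
  refine ⟨Matrix.det ((X : ℝ[X]) • M.map C + (1 : Matrix _ _ ℝ).map C), ?_, fun t => ?_⟩
  · simpa using natDegree_det_X_add_C_le M 1
  · have h1 : (1 + t • A).det = LinearMap.det ((1 + t • A : E →L[ℝ] E) : E →ₗ[ℝ] E) := rfl
    have h2 : LinearMap.toMatrix b b ((1 + t • A : E →L[ℝ] E) : E →ₗ[ℝ] E) = 1 + t • M := by
      rw [hM, ← map_smul, ← LinearMap.toMatrix_one b, ← map_add]
      rfl
    rw [h1, ← LinearMap.det_toMatrix b, h2, ← coe_evalRingHom, RingHom.map_det]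
    congr 1
    ext i j
    by_cases hij : i = j <;> simp [hij, add_comm, mul_comm t]

theorem exists_forall_det_one_add_pos (E : Type*) [NormedAddCommGroup E] [NormedSpace ℝ E]
    [FiniteDimensional ℝ E] :
    ∃ ρ : ℝ, 0 < ρ ∧ ∀ A : E →L[ℝ] E, ‖A‖ < ρ → 0 < (1 + A).det := by
  have hc : Continuous fun A : E →L[ℝ] E => (1 + A).det :=
    ContinuousLinearMap.continuous_det.comp (continuous_const.add continuous_id)
  have h0 : ∀ᶠ A in 𝓝 (0 : E →L[ℝ] E), 0 < (1 + A).det := by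
    refine hc.continuousAt.eventually (lt_mem_nhds ?_)
    have : (1 + 0 : E →L[ℝ] E).det = LinearMap.det (LinearMap.id : E →ₗ[ℝ] E) := by
      rw [add_zero]; rfl
    change 0 < (1 + 0 : E →L[ℝ] E).det
    rw [this]
    simp
  obtain ⟨ρ, hρ, h⟩ := Metric.eventually_nhds_iff.1 h0
  exact ⟨ρ, hρ, fun A hA => h (by simpa using hA)⟩

/-- A small Lipschitz perturbation of the identity that is supported in `U` maps `U` bijectively
onto itself. -/
theorem injective_and_image_eq_of_lipschitzWith {u : E → E} {K : NNReal} (hu : LipschitzWith K u)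
    {U : Set E} (hU : ∀ x ∉ U, u x = 0) {t : ℝ} (ht : 0 ≤ t) (htK : t * K < 1) :
    Function.Injective (fun x => x + t • u x) ∧ (fun x => x + t • u x) '' U = U := by
  have hK : ∀ x y, ‖t • u x - t • u y‖ ≤ t * K * ‖x - y‖ := by
    intro x y
    rw [← smul_sub, norm_smul, Real.norm_of_nonneg ht, mul_assoc]
    gcongr
    simpa [dist_eq_norm] using hu.dist_le_mul x y
  have hinj : Function.Injective (fun x => x + t • u x) := by
    intro x y hxy
    have h1 : x - y = t • u y - t • u x := by
      have : x + t • u x = y + t • u y := hxy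
      rw [sub_eq_sub_iff_add_eq_add, this, add_comm]
    have h2 := hK y x
    rw [← h1, norm_sub_rev y x] at h2
    have : ‖x - y‖ = 0 := by nlinarith [norm_nonneg (x - y)]
    exact sub_eq_zero.1 (norm_eq_zero.1 this)
  have hfix : ∀ x ∉ U, x + t • u x = x := fun x hx => by simp [hU x hx]
  refine ⟨hinj, Subset.antisymm ?_ ?_⟩
  · rintro _ ⟨x, hx, rfl⟩
    by_contra hy
    have : x + t • u x = x := hinj (hfix _ hy)
    exact hy (by simpa only [this] using hx)
  · intro y hy
    -- A preimage of `y` is a fixed point of `x ↦ y - t • u x`; it lies in `U` because the perturbed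
    -- map is the identity elsewhere.
    have hcontr : ContractingWith (⟨t * K, by positivity⟩ : NNReal) (fun x => y - t • u x) := by
      refine ⟨by exact_mod_cast htK, LipschitzWith.of_dist_le_mul fun a b => ?_⟩
      rw [dist_eq_norm, dist_eq_norm, sub_sub_sub_cancel_left, norm_sub_rev a b]
      exact hK b a
    have hx := hcontr.fixedPoint_isFixedPt
    set x := hcontr.fixedPoint
    have hx' : x + t • u x = y := by
      nth_rw 1 [← hx.eq]
      simp
    refine ⟨x, ?_, hx'⟩
    by_contra hxU
    rw [hfix x hxU] at hx'
    exact hxU (hx' ▸ hy)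

variable [MeasurableSpace E] [BorelSpace E]

/-- A Lipschitz perturbation of the identity supported in an open set `U` preserves the signed
volume of `U`. -/
theorem integral_det_one_add_fderiv {u : E → E} {K : NNReal} (hu : LipschitzWith K u)
    {U : Set E} (hUo : IsOpen U) (hU : ∀ x ∉ U, u x = 0)
    (hUf : μH[Module.finrank ℝ E] U ≠ ⊤) :
    ∫ x in U ∩ {x | DifferentiableAt ℝ u x}, (1 + fderiv ℝ u x).det ∂μH[Module.finrank ℝ E] =
      (μH[Module.finrank ℝ E]).real U := by
  set μ : Measure E := μH[Module.finrank ℝ E] with hμ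
  set S := U ∩ {x | DifferentiableAt ℝ u x} with hS
  have hSm : MeasurableSet S := hUo.measurableSet.inter (measurableSet_of_differentiableAt ℝ u)
  have hnull : μ (U \ S) = 0 := by
    refine measure_mono_null ?_ (ae_iff.1 hu.ae_differentiableAt)
    intro x hx hd
    exact hx.2 ⟨hx.1, hd⟩
  obtain ⟨ρ, hρ, hdet⟩ := exists_forall_det_one_add_pos E
  -- For `t < δ` the bound `t K < 1` gives bijectivity on `U`, and `t K < ρ` makes the determinant
  -- positive, so that the change of variables formula needs no absolute value.
  set δ : ℝ := min 1 ρ / (K + 1) with hδdef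
  have hδ : 0 < δ := by positivity
  have key : ∀ t ∈ Ioo 0 δ, IntegrableOn (fun x => (1 + t • fderiv ℝ u x).det) S μ ∧
      ∫ x in S, (1 + t • fderiv ℝ u x).det ∂μ = μ.real U := by
    intro t ht
    have ht' : t * (K + 1) < min 1 ρ := by
      have := ht.2
      rwa [hδdef, lt_div_iff₀ (by positivity)] at this
    have htK : t * K < min 1 ρ := by nlinarith [ht.1]
    obtain ⟨hinj, himg⟩ := injective_and_image_eq_of_lipschitzWith hu hU ht.1.le
      (htK.trans_le (min_le_left _ _))
    set f : E → E := fun x => x + t • u x with hf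
    have hfL : ∃ C, LipschitzWith C f :=
      ⟨_, LipschitzWith.id.add ((lipschitzWith_smul t).comp hu)⟩
    obtain ⟨C, hfL⟩ := hfL
    have hfS : μ (f '' S) = μ U := by
      refine le_antisymm ?_ ?_
      · rw [← himg]
        exact measure_mono (image_mono inter_subset_left)
      · have h0 : μ (f '' (U \ S)) = 0 := by
          have := hfL.hausdorffMeasure_image_le (d := (Module.finrank ℝ E : ℝ))
            (Nat.cast_nonneg _) (U \ S)
          rw [← hμ, hnull, mul_zero] at this
          exact le_antisymm this bot_le
        calc μ U = μ (f '' U) := by rw [himg]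
          _ = μ (f '' S ∪ f '' (U \ S)) := by
            rw [← image_union, union_sdiff_cancel inter_subset_left]
          _ ≤ μ (f '' S) + μ (f '' (U \ S)) := measure_union_le _ _
          _ = μ (f '' S) := by rw [h0, add_zero]
    have hderiv : ∀ x ∈ S, HasFDerivWithinAt f (1 + t • fderiv ℝ u x) S x := fun x hx =>
      ((hasFDerivAt_id x).add (hx.2.hasFDerivAt.const_smul t)).hasFDerivWithinAt
    have habs : ∀ x ∈ S, |(1 + t • fderiv ℝ u x).det| • (1 : ℝ) = (1 + t • fderiv ℝ u x).det := by
      intro x _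
      rw [smul_eq_mul, mul_one, abs_of_pos]
      refine hdet _ ?_
      rw [norm_smul, Real.norm_of_nonneg ht.1.le]
      calc t * ‖fderiv ℝ u x‖ ≤ t * K := by
            gcongr
            · exact ht.1.le
            · exact norm_fderiv_le_of_lipschitz ℝ hu
        _ < ρ := htK.trans_le (min_le_right _ _)
    constructor
    · rw [← integrableOn_congr_fun habs hSm]
      rw [← integrableOn_image_iff_integrableOn_abs_det_fderiv_smul μ hSm hderiv hinj.injOn
        (fun _ => (1 : ℝ))]
      exact integrableOn_const (by rwa [hfS])
    · rw [← setIntegral_congr_fun hSm habs,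
        ← integral_image_eq_integral_abs_det_fderiv_smul μ hSm hderiv hinj.injOn
        (fun _ => (1 : ℝ))]
      simp [Measure.real, hfS]
  -- Extrapolation from small parameters to `t = 1`; the weights sum to one because the formula is
  -- exact on constants.
  obtain ⟨a, w, ha, hw⟩ := exists_extrapolation (Module.finrank ℝ E) hδ
  have hpt : ∀ x, (1 + fderiv ℝ u x).det = ∑ i ∈ Finset.range (Module.finrank ℝ E + 1),
      w i * (1 + a i • fderiv ℝ u x).det := by
    intro x
    obtain ⟨p, hp, hpe⟩ := exists_polynomial_det_one_add_smul (fderiv ℝ u x)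
    have := hw p hp
    simp only [hpe, one_smul] at this
    exact this
  have hw1 : ∑ i ∈ Finset.range (Module.finrank ℝ E + 1), w i = 1 := by
    simpa using (hw 1 (by simp)).symm
  simp only [hpt]
  rw [integral_finsetSum _ fun i _ => ((key _ (ha i)).1.const_mul (w i))]
  simp only [integral_const_mul, (key _ (ha _)).2]
  rw [← Finset.sum_mul, hw1, one_mul]

end Brouwer

end BorkarMeyn

namespace BorkarMeyn

/-! ### Non-retraction and zeros of Lipschitz maps -/

section Brouwer

open MeasureTheory

/-- The product of a compactly supported Lipschitz scalar function and a Lipschitz function is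
Lipschitz. -/
theorem exists_lipschitzWith_smul {E F : Type*} [NormedAddCommGroup E] [NormedAddCommGroup F]
    [NormedSpace ℝ F] {ψ : E → ℝ} {f : E → F} {K C : NNReal} {B R : ℝ}
    (hψ : LipschitzWith K ψ) (hf : LipschitzWith C f) (hB : ∀ x, |ψ x| ≤ B)
    (hR : ∀ x, R ≤ ‖x‖ → ψ x = 0) : ∃ D, LipschitzWith D (fun x => ψ x • f x) := by
  have hB0 : 0 ≤ B := (abs_nonneg _).trans (hB 0)
  set M : ℝ := ‖f 0‖ + C * |R| with hM
  have hM0 : 0 ≤ M := by positivity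
  have key : ∀ x y, ‖x‖ < R → ‖ψ x • f x - ψ y • f y‖ ≤ (K * M + B * C) * ‖x - y‖ := by
    intro x y hx
    have h1 : ‖f x‖ ≤ M := by
      have h2 := hf.dist_le_mul x 0
      rw [dist_eq_norm, dist_eq_norm, sub_zero] at h2
      have h3 : ‖f x‖ ≤ ‖f x - f 0‖ + ‖f 0‖ := by simpa using norm_add_le (f x - f 0) (f 0)
      have h4 : (C : ℝ) * ‖x‖ ≤ C * |R| := by
        gcongr
        exact hx.le.trans (le_abs_self R)
      linarith
    have h5 : |ψ x - ψ y| ≤ K * ‖x - y‖ := by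
      simpa [dist_eq_norm] using hψ.dist_le_mul x y
    have h6 : ‖f x - f y‖ ≤ C * ‖x - y‖ := by simpa [dist_eq_norm] using hf.dist_le_mul x y
    have h7 : ψ x • f x - ψ y • f y = (ψ x - ψ y) • f x + ψ y • (f x - f y) := by
      rw [sub_smul, smul_sub]; abel
    calc ‖ψ x • f x - ψ y • f y‖ ≤ |ψ x - ψ y| * ‖f x‖ + |ψ y| * ‖f x - f y‖ := by
          rw [h7]
          refine (norm_add_le _ _).trans (le_of_eq ?_)
          simp [norm_smul]
      _ ≤ (K * ‖x - y‖) * M + B * (C * ‖x - y‖) := by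
          gcongr
          exact hB y
      _ = (K * M + B * C) * ‖x - y‖ := by ring
  refine ⟨⟨K * M + B * C, by positivity⟩, LipschitzWith.of_dist_le_mul fun x y => ?_⟩
  rw [dist_eq_norm, dist_eq_norm]
  change _ ≤ (K * M + B * C) * ‖x - y‖
  by_cases hx : ‖x‖ < R
  · exact key x y hx
  · by_cases hy : ‖y‖ < R
    · rw [norm_sub_rev, norm_sub_rev x y]
      exact key y x hy
    · rw [hR x (not_lt.1 hx), hR y (not_lt.1 hy)]
      simp only [zero_smul, sub_self, norm_zero]
      positivity

/-- A Lipschitz map that coincides with the radial retraction onto the sphere of radius `R` on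
`{ε ≤ ‖y‖ ≤ R}` and with the identity outside of this sphere. -/
theorem exists_lipschitzWith_retraction (E : Type*) [NormedAddCommGroup E] [NormedSpace ℝ E]
    {ε R : ℝ} (hε : 0 < ε) (hR : ε ≤ R) :
    ∃ (ρ : E → E) (D : NNReal), LipschitzWith D ρ ∧ (∀ y, R ≤ ‖y‖ → ρ y = y) ∧
      ∀ y, ε ≤ ‖y‖ → ‖y‖ ≤ R → ‖ρ y‖ = R := by
  have hR0 : 0 < R := hε.trans_le hR
  -- The retraction multiplies `y` by `1 + ψ y`. The cut-off at `ε` keeps the factor Lipschitz, and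
  -- subtracting 1 makes it vanish outside the ball.
  set ψ : E → ℝ := fun y => max 1 (R / max ε ‖y‖) - 1 with hψ
  have hpos : ∀ y : E, 0 < max ε ‖y‖ := fun y => hε.trans_le (le_max_left _ _)
  have hψL : LipschitzWith ⟨R / (ε * ε), by positivity⟩ ψ := by
    refine LipschitzWith.of_dist_le_mul fun x y => ?_
    have h1 : |max 1 (R / max ε ‖x‖) - max 1 (R / max ε ‖y‖)| ≤
        |R / max ε ‖x‖ - R / max ε ‖y‖| := by
      simpa [max_comm] using abs_max_sub_max_le_abs (R / max ε ‖x‖) (R / max ε ‖y‖) 1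
    have h2 : |max ε ‖y‖ - max ε ‖x‖| ≤ ‖x - y‖ := by
      have := abs_max_sub_max_le_abs ‖y‖ ‖x‖ ε
      rw [max_comm ε, max_comm ε, norm_sub_rev]
      exact this.trans (abs_norm_sub_norm_le y x)
    rw [Real.dist_eq, dist_eq_norm]
    simp only [hψ, sub_sub_sub_cancel_right]
    refine h1.trans ?_
    rw [div_sub_div _ _ (hpos x).ne' (hpos y).ne', abs_div, ← mul_comm R, ← mul_sub, abs_mul,
      abs_of_pos hR0, abs_of_pos (mul_pos (hpos x) (hpos y))]
    change _ ≤ R / (ε * ε) * ‖x - y‖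
    rw [div_mul_eq_mul_div]
    gcongr
    · exact le_max_left _ _
    · exact le_max_left _ _
  have hψ0 : ∀ y, R ≤ ‖y‖ → ψ y = 0 := by
    intro y hy
    have : R / max ε ‖y‖ ≤ 1 := by
      rw [div_le_one (hpos y)]
      exact hy.trans (le_max_right _ _)
    simp [hψ, max_eq_left this]
  have hψB : ∀ y, |ψ y| ≤ R / ε := by
    intro y
    have h1 : 1 ≤ max 1 (R / max ε ‖y‖) := le_max_left _ _
    have h2 : R / max ε ‖y‖ ≤ R / ε := by
      gcongr
      exact le_max_left _ _
    have h3 : 1 ≤ R / ε := by rwa [one_le_div hε]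
    rw [abs_of_nonneg (by simp only [hψ]; linarith)]
    have := max_le h3 h2
    simp only [hψ]
    linarith
  obtain ⟨D, hD⟩ := exists_lipschitzWith_smul hψL (LipschitzWith.id (α := E)) hψB hψ0
  refine ⟨fun y => y + ψ y • y, 1 + D, LipschitzWith.id.add hD, fun y hy => by simp [hψ0 y hy],
    fun y hy hyR => ?_⟩
  have hy0 : 0 < ‖y‖ := hε.trans_le hy
  have h1 : 1 ≤ R / ‖y‖ := by rwa [one_le_div hy0]
  have h2 : y + ψ y • y = (R / ‖y‖) • y := by
    simp only [hψ, max_eq_right hy, max_eq_right h1]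
    rw [sub_smul, one_smul]
    abel
  simp only [h2]
  rw [norm_smul, Real.norm_of_nonneg (by positivity)]
  field_simp

/-- A map into a sphere has a singular derivative. -/
theorem det_eq_zero_of_norm_eventually_const {E : Type*} [NormedAddCommGroup E]
    [InnerProductSpace ℝ E] [FiniteDimensional ℝ E] {G : E → E} {G' : E →L[ℝ] E} {x : E} {R : ℝ}
    (hR : 0 < R) (hG : HasFDerivAt G G' x) (hc : ∀ᶠ y in 𝓝 x, ‖G y‖ = R) : G'.det = 0 := by
  by_contra hdet
  -- Differentiating `‖G‖² = R²` makes `G x` orthogonal to the range of `G'`; were `G'` surjective,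
  -- `G x` would be orthogonal to itself.
  have hzero : ∀ v, 2 * inner ℝ (G x) (G' v) = 0 := by
    intro v
    have h1 := hG.norm_sq
    have h2 : HasFDerivAt (fun y => ‖G y‖ ^ 2) (0 : E →L[ℝ] ℝ) x := by
      refine (hasFDerivAt_const (R ^ 2) x).congr_of_eventuallyEq ?_
      filter_upwards [hc] with y hy
      rw [hy]
    have h3 := congrArg (fun A : E →L[ℝ] ℝ => A v) (h1.unique h2)
    simpa using h3
  have hsurj : Function.Surjective (G' : E →ₗ[ℝ] E) := by
    rw [← LinearMap.range_eq_top, ← LinearMap.isUnit_iff_range_eq_top]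
    exact (LinearMap.isUnit_iff_isUnit_det _).2 (isUnit_iff_ne_zero.2 hdet)
  obtain ⟨v, hv⟩ := hsurj (G x)
  have h1 := hzero v
  have h2 : G' v = G x := hv
  rw [h2, real_inner_self_eq_norm_sq, hc.self_of_nhds] at h1
  nlinarith

/-- Without a zero, `g` followed by the radial retraction maps a large ball into its sphere and
fixes the outside. Its determinant then vanishes wherever it is differentiable in the ball, yet
integrates to the positive volume. -/
theorem exists_zero_of_eq_id_of_inner {E : Type*} [NormedAddCommGroup E]
    [InnerProductSpace ℝ E] [FiniteDimensional ℝ E] {g : E → E} {K : NNReal}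
    (hg : LipschitzWith K g) {R₀ : ℝ} (hgid : ∀ x, R₀ ≤ ‖x‖ → g x = x) : ∃ x, g x = 0 := by
  by_contra! hne
  borelize E
  have hcpt : IsCompact (Metric.closedBall (0 : E) (max R₀ 1)) := isCompact_closedBall _ _
  have hnn : (Metric.closedBall (0 : E) (max R₀ 1)).Nonempty := ⟨0, by simp⟩
  obtain ⟨x₁, -, hmin⟩ := hcpt.exists_isMinOn hnn hg.continuous.norm.continuousOn
  obtain ⟨x₂, -, hmax⟩ := hcpt.exists_isMaxOn hnn hg.continuous.norm.continuousOn
  -- `ε` bounds `‖g‖` below everywhere, the 1 covering the region where `g` is the identity; `R` is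
  -- large enough that `g` maps the ball of radius `R` into the closed one.
  set ε : ℝ := min ‖g x₁‖ 1 with hεdef
  have hε : 0 < ε := lt_min (norm_pos_iff.2 (hne x₁)) one_pos
  set R : ℝ := max (max R₀ 1) ‖g x₂‖ + 1 with hRdef
  have hR1 : max R₀ 1 < R := by
    have := le_max_left (max R₀ 1) ‖g x₂‖
    linarith
  have h1R : 1 < R := (le_max_right R₀ 1).trans_lt hR1
  have hR0 : 0 < R := one_pos.trans h1R
  have hge : ∀ x, ε ≤ ‖g x‖ := by
    intro x
    rcases le_total ‖x‖ (max R₀ 1) with hx | hx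
    · exact (min_le_left _ _).trans (hmin (by simpa using hx))
    · rw [hgid x ((le_max_left _ _).trans hx)]
      exact (min_le_right _ _).trans ((le_max_right _ _).trans hx)
  have hlt : ∀ x, ‖x‖ < R → ‖g x‖ ≤ R := by
    intro x hxR
    rcases le_total ‖x‖ (max R₀ 1) with hx | hx
    · have h1 : ‖g x‖ ≤ ‖g x₂‖ := hmax (by simpa using hx)
      have h2 := le_max_right (max R₀ 1) ‖g x₂‖
      linarith
    · rw [hgid x ((le_max_left _ _).trans hx)]
      exact hxR.le
  obtain ⟨ρ, D, hρL, hρid, hρR⟩ :=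
    exists_lipschitzWith_retraction E hε ((min_le_right _ _).trans h1R.le : ε ≤ R)
  set u : E → E := fun x => ρ (g x) - x with hu
  have huL : LipschitzWith (D * K + 1) u := (hρL.comp hg).sub LipschitzWith.id
  have hu0 : ∀ x ∉ Metric.ball (0 : E) R, u x = 0 := by
    intro x hx
    have hx' : R ≤ ‖x‖ := by simpa using hx
    have hgx : g x = x := hgid x ((le_max_left _ _).trans (hR1.le.trans hx'))
    simp [hu, hgx, hρid x hx']
  have hint := integral_det_one_add_fderiv huL Metric.isOpen_ball hu0
    (isBounded_iff_forall_norm_le.2 ⟨R, fun x hx => (by simpa using hx : ‖x‖ < R).le⟩ :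
      Bornology.IsBounded (Metric.ball (0 : E) R)).measure_lt_top.ne
  rw [setIntegral_eq_zero_of_forall_eq_zero] at hint
  · have hpos : 0 < (Measure.hausdorffMeasure (Module.finrank ℝ E) : Measure E).real
        (Metric.ball (0 : E) R) :=
      ENNReal.toReal_pos (Metric.measure_ball_pos _ _ hR0).ne' Metric.isBounded_ball.measure_lt_top.ne
    exact hpos.ne hint
  · rintro x ⟨hxU, hxd⟩
    have hder : HasFDerivAt (fun y => ρ (g y)) (1 + fderiv ℝ u x) x := by
      have := (hasFDerivAt_id x).add hxd.hasFDerivAt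
      refine this.congr_of_eventuallyEq (Eventually.of_forall fun y => ?_)
      simp [hu]
    refine det_eq_zero_of_norm_eventually_const hR0 hder ?_
    filter_upwards [Metric.isOpen_ball.mem_nhds hxU] with y hy
    exact hρR _ (hge y) (hlt y (by simpa using hy))

/-- A Lipschitz self-map of a finite-dimensional space that is the identity outside a bounded set
has a zero. -/
theorem exists_zero_of_eq_id {E : Type*} [NormedAddCommGroup E] [NormedSpace ℝ E]
    [FiniteDimensional ℝ E] {g : E → E} {K : NNReal}
    (hg : LipschitzWith K g) {R : ℝ} (hgid : ∀ x, R ≤ ‖x‖ → g x = x) : ∃ x, g x = 0 := by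
  set e := toEuclidean (E := E)
  obtain ⟨y, hy⟩ := exists_zero_of_eq_id_of_inner (R₀ := ‖(e : E →L[ℝ] EuclideanSpace ℝ (Fin (Module.finrank ℝ E)))‖ * |R| + 1)
    ((e.lipschitz.comp hg).comp e.symm.lipschitz) (fun y hy => by
      have hRy : R ≤ ‖e.symm y‖ := by
        by_contra! hlt
        have h1 := (e : E →L[ℝ] EuclideanSpace ℝ (Fin (Module.finrank ℝ E))).le_opNorm (e.symm y)
        have h2 : ‖(e : E →L[ℝ] EuclideanSpace ℝ (Fin (Module.finrank ℝ E)))‖ * ‖e.symm y‖ ≤ ‖(e : E →L[ℝ] EuclideanSpace ℝ (Fin (Module.finrank ℝ E)))‖ * |R| := by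
          gcongr
          exact hlt.le.trans (le_abs_self R)
        simp only [ContinuousLinearEquiv.coe_coe, ContinuousLinearEquiv.apply_symm_apply] at h1
        linarith
      simp [hgid _ hRy])
  exact ⟨e.symm y, by simpa using hy⟩

end Brouwer

end BorkarMeyn

namespace BorkarMeyn

/-! ### Forward flow and Grönwall estimates -/

section Flow

variable {d : ℕ} {h : (Fin d → ℝ) → Fin d → ℝ} {K : NNReal}

theorem IsForwardSolution.continuousOn {x : ℝ → Fin d → ℝ} (hx : IsForwardSolution h x) :
    ContinuousOn x (Ici 0) := fun t ht => (hx t ht).continuousWithinAt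

theorem IsForwardSolution.hasDerivWithinAt_Ici {x : ℝ → Fin d → ℝ} (hx : IsForwardSolution h x)
    {t : ℝ} (ht : 0 ≤ t) : HasDerivWithinAt x (h (x t)) (Ici t) t :=
  (hx t ht).mono (Ici_subset_Ici.2 ht)

theorem IsForwardSolution.shift {x : ℝ → Fin d → ℝ} (hx : IsForwardSolution h x)
    {s : ℝ} (hs : 0 ≤ s) : IsForwardSolution h (fun t => x (t + s)) := by
  intro t ht
  have := (hx (t + s) (by positivity)).scomp (h := fun r => r + s) (s := Ici 0) t
    ((hasDerivAt_id t).add_const s).hasDerivWithinAt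
    (fun r hr => add_nonneg (mem_Ici.1 hr) hs)
  simpa [Function.comp_def] using this

theorem isForwardSolution_const {p : Fin d → ℝ} (hp : h p = 0) :
    IsForwardSolution h (fun _ => p) := by
  intro t _
  simpa [hp] using hasDerivWithinAt_const t (Ici 0) p

theorem IsForwardSolution.dist_le {x y : ℝ → Fin d → ℝ} (hh : LipschitzWith K h)
    (hx : IsForwardSolution h x) (hy : IsForwardSolution h y) {t : ℝ} (ht : 0 ≤ t) :
    dist (x t) (y t) ≤ dist (x 0) (y 0) * Real.exp (K * t) := by
  have := dist_le_of_trajectories_ODE (v := fun _ => h) (a := 0) (b := t) (fun _ => hh)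
    (hx.continuousOn.mono Icc_subset_Ici_self) (fun s hs => hx.hasDerivWithinAt_Ici hs.1)
    (hy.continuousOn.mono Icc_subset_Ici_self) (fun s hs => hy.hasDerivWithinAt_Ici hs.1)
    le_rfl t ⟨ht, le_rfl⟩
  simpa using this

theorem IsForwardSolution.eq_of_eq_zero {x y : ℝ → Fin d → ℝ} (hh : LipschitzWith K h)
    (hx : IsForwardSolution h x) (hy : IsForwardSolution h y) (h0 : x 0 = y 0) {t : ℝ}
    (ht : 0 ≤ t) : x t = y t := by
  have := hx.dist_le hh hy ht
  rw [h0, dist_self, zero_mul] at this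
  exact dist_le_zero.1 this

/-- The forward flow of a Lipschitz vector field. -/
theorem exists_flow (hh : LipschitzWith K h) :
    ∃ φ : ℝ → (Fin d → ℝ) → Fin d → ℝ, ∀ x, φ 0 x = x ∧ IsForwardSolution h (fun t => φ t x) := by
  choose x hx0 hx using exists_solution_Ici hh
  exact ⟨fun t p => x p t, fun p => ⟨hx0 p, hx p⟩⟩

/-- The deviation of a forward solution of `ẋ = h(x)` from one of `ẋ = g(x)` that starts at the same
point. -/
theorem IsForwardSolution.dist_le_of_approx {g : (Fin d → ℝ) → Fin d → ℝ} {x y : ℝ → Fin d → ℝ}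
    (hh : LipschitzWith K h) (hK : 1 ≤ K) (hx : IsForwardSolution h x)
    (hy : IsForwardSolution g y) (h0 : x 0 = y 0) {ε : ℝ}
    (hε : ∀ t ∈ Icc (0 : ℝ) 1, dist (g (y t)) (h (y t)) ≤ ε) {t : ℝ} (ht : t ∈ Icc (0 : ℝ) 1) :
    dist (x t) (y t) ≤ ε * t * Real.exp K := by
  have hε0 : 0 ≤ ε := dist_nonneg.trans (hε t ht)
  have hK1 : (1 : ℝ) ≤ K := by exact_mod_cast hK
  have hK0 : (0 : ℝ) < K := one_pos.trans_le hK1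
  have := dist_le_of_approx_trajectories_ODE (v := fun _ => h) (a := 0) (b := 1) (δ := 0)
    (εf := 0) (εg := ε) (fun _ => hh)
    (hx.continuousOn.mono Icc_subset_Ici_self) (fun s hs => hx.hasDerivWithinAt_Ici hs.1)
    (fun s _ => (dist_self _).le)
    (hy.continuousOn.mono Icc_subset_Ici_self) (fun s hs => hy.hasDerivWithinAt_Ici hs.1)
    (fun s hs => hε s ⟨hs.1, hs.2.le⟩) (by rw [h0, dist_self]) t ht
  refine this.trans ?_
  rw [gronwallBound_of_K_ne_0 hK0.ne']
  -- The inequality `exp u - 1 ≤ u exp u` retains a factor `t`, needed to compare the error with a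
  -- decrease linear in time.
  have h1 : Real.exp (K * t) - 1 ≤ K * t * Real.exp (K * t) := by
    have h2 := Real.add_one_le_exp (-(K * t))
    have h3 : Real.exp (-(K * t)) * Real.exp (K * t) = 1 := by
      rw [← Real.exp_add]; simp
    nlinarith [Real.exp_pos (K * t)]
  have h4 : Real.exp (K * t) ≤ Real.exp K := by
    refine Real.exp_le_exp.2 ?_
    nlinarith [ht.2]
  have ht0 := ht.1
  simp only [zero_mul, zero_add, sub_zero]
  calc ε / K * (Real.exp (K * t) - 1) ≤ ε / K * (K * t * Real.exp K) := by
        gcongr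
        exact h1.trans (by gcongr)
    _ = ε * t * Real.exp K := by field_simp

/-- Short-time expansion of a forward solution that stays where `‖h‖ ≤ C`. -/
theorem IsForwardSolution.norm_sub_sub_smul_le {x : ℝ → Fin d → ℝ} (hh : LipschitzWith K h)
    (hx : IsForwardSolution h x) {C : ℝ} (hC : ∀ t, 0 ≤ t → ‖h (x t)‖ ≤ C) {t : ℝ} (ht : 0 ≤ t) :
    ‖x t - x 0 - t • h (x 0)‖ ≤ K * C * t * t := by
  have h1 : ∀ s, 0 ≤ s → ‖x s - x 0‖ ≤ C * s := by
    intro s hs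
    have := norm_image_sub_le_of_norm_deriv_le_segment' (f := x) (a := 0) (b := s)
      (f' := fun r => h (x r)) (C := C)
      (fun r hr => (hx r hr.1).mono (show Icc (0 : ℝ) s ⊆ Ici 0 from Icc_subset_Ici_self)) (fun r hr => hC r hr.1) s ⟨hs, le_rfl⟩
    simpa using this
  have h2 := norm_image_sub_le_of_norm_deriv_le_segment' (f := fun r => x r - r • h (x 0))
    (a := 0) (b := t) (f' := fun r => h (x r) - h (x 0)) (C := K * C * t)
    (fun r hr => by
      have := ((hx r hr.1).mono (show Icc (0 : ℝ) t ⊆ Ici 0 from Icc_subset_Ici_self)).sub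
        ((hasDerivAt_id r).smul_const (h (x 0))).hasDerivWithinAt
      rw [one_smul] at this
      exact this)
    (fun r hr => by
      have h3 := hh.dist_le_mul (x r) (x 0)
      rw [dist_eq_norm, dist_eq_norm] at h3
      have hC0 : 0 ≤ C := (norm_nonneg _).trans (hC 0 le_rfl)
      calc ‖h (x r) - h (x 0)‖ ≤ K * ‖x r - x 0‖ := h3
        _ ≤ K * (C * t) := by
          gcongr
          exact (h1 r hr.1).trans (by gcongr; exact hr.2.le)
        _ = K * C * t := by ring)
    t ⟨ht, le_rfl⟩
  have h4 : x t - x 0 - t • h (x 0) = x t - t • h (x 0) - (x 0 - (0 : ℝ) • h (x 0)) := by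
    rw [zero_smul]; abel
  rw [h4]
  simpa using h2

end Flow

/-! ### The scaling limit at infinity -/

section ScalingLimit

variable {d : ℕ} {h hInf : (Fin d → ℝ) → Fin d → ℝ} {K : NNReal}

theorem lipschitzWith_scaling_limit (hh : LipschitzWith K h)
    (hlim : ∀ x, Tendsto (fun c : ℝ => c⁻¹ • h (c • x)) atTop (𝓝 (hInf x))) :
    LipschitzWith K hInf := by
  refine LipschitzWith.of_dist_le_mul fun x y => ?_
  refine le_of_tendsto ((hlim x).dist (hlim y)) ?_
  filter_upwards [eventually_gt_atTop (0 : ℝ)] with c hc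
  rw [dist_smul₀, Real.norm_of_nonneg (inv_nonneg.2 hc.le), inv_mul_le_iff₀ hc]
  have := hh.dist_le_mul (c • x) (c • y)
  rw [dist_smul₀, Real.norm_of_nonneg hc.le] at this
  linarith

/-- Substitute `a * c` for the scaling parameter `a`; the case `c = 0` escapes this and is the
equilibrium condition. -/
theorem scaling_limit_smul
    (hlim : ∀ x, Tendsto (fun c : ℝ => c⁻¹ • h (c • x)) atTop (𝓝 (hInf x)))
    (h0 : hInf 0 = 0) {c : ℝ} (hc : 0 ≤ c) (x : Fin d → ℝ) : hInf (c • x) = c • hInf x := by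
  rcases hc.eq_or_lt with rfl | hc
  · simp [h0]
  · have h1 : Tendsto (fun a : ℝ => c • ((a * c)⁻¹ • h ((a * c) • x))) atTop (𝓝 (c • hInf x)) :=
      ((hlim x).comp (tendsto_id.atTop_mul_const hc)).const_smul c
    refine tendsto_nhds_unique (hlim (c • x)) (h1.congr fun a => ?_)
    rw [smul_smul, smul_smul, mul_inv_rev, ← mul_assoc, mul_inv_cancel₀ hc.ne', one_mul]

/-- `h` differs from its scaling limit by an amount that is sublinear at infinity. -/
theorem exists_dist_scaling_limit_le (hh : LipschitzWith K h)
    (hlim : ∀ A : Set (Fin d → ℝ), IsCompact A →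
      TendstoUniformlyOn (fun (c : ℝ) x => c⁻¹ • h (c • x)) hInf atTop A)
    (hL : LipschitzWith K hInf) (hs : ∀ c : ℝ, 0 ≤ c → ∀ x, hInf (c • x) = c • hInf x)
    {η : ℝ} (hη : 0 < η) : ∃ C : ℝ, 0 ≤ C ∧ ∀ x, dist (hInf x) (h x) ≤ η * ‖x‖ + C := by
  -- Used at the unit vector `x / ‖x‖` with scale `‖x‖`, when that is large; smaller `x` are
  -- absorbed into the constant.
  have h1 := Metric.tendstoUniformlyOn_iff.1 (hlim _ (isCompact_closedBall 0 1)) η hη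
  obtain ⟨c₀, hc₀⟩ := eventually_atTop.1 h1
  set c := max c₀ 1 with hcdef
  have hc1 : 1 ≤ c := le_max_right _ _
  refine ⟨dist (hInf 0) (h 0) + 2 * K * c, by positivity, fun x => ?_⟩
  rcases le_total ‖x‖ c with hx | hx
  · have h2 := hL.dist_le_mul x 0
    have h3 := hh.dist_le_mul 0 x
    have h4 := dist_triangle4 (hInf x) (hInf 0) (h 0) (h x)
    rw [dist_zero_right] at h2
    rw [dist_zero_left] at h3
    have h5 : (K : ℝ) * ‖x‖ ≤ K * c := by gcongr
    have h6 : 0 ≤ η * ‖x‖ := by positivity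
    linarith
  · have hx0 : 0 < ‖x‖ := one_pos.trans_le (hc1.trans hx)
    have h2 := hc₀ ‖x‖ ((le_max_left _ _).trans hx) (‖x‖⁻¹ • x) (by
      simp [norm_smul, hx0.ne'])
    rw [hs _ (by positivity), smul_smul, mul_inv_cancel₀ hx0.ne', one_smul, dist_smul₀, norm_inv,
      norm_norm, inv_mul_lt_iff₀ hx0] at h2
    have h3 : 0 ≤ dist (hInf 0) (h 0) + 2 * K * c := by positivity
    linarith

end ScalingLimit

end BorkarMeyn

namespace BorkarMeyn

/-! ### Lyapunov function of the homogeneous limit -/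

section Lyapunov

variable {d : ℕ} {g : (Fin d → ℝ) → Fin d → ℝ} {K : NNReal} {φ : ℝ → (Fin d → ℝ) → Fin d → ℝ}

theorem dist_flow_le (hg : LipschitzWith K g)
    (hφ : ∀ x, φ 0 x = x ∧ IsForwardSolution g (fun t => φ t x)) {t : ℝ} (ht : 0 ≤ t)
    (x y : Fin d → ℝ) : dist (φ t x) (φ t y) ≤ Real.exp (K * t) * dist x y := by
  have := (hφ x).2.dist_le hg (hφ y).2 ht
  rwa [(hφ x).1, (hφ y).1, mul_comm] at this

theorem flow_add (hg : LipschitzWith K g)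
    (hφ : ∀ x, φ 0 x = x ∧ IsForwardSolution g (fun t => φ t x)) {s t : ℝ} (ht : 0 ≤ t)
    (hs : 0 ≤ s) (x : Fin d → ℝ) : φ (t + s) x = φ t (φ s x) :=
  ((hφ x).2.shift hs).eq_of_eq_zero hg (hφ (φ s x)).2 (by simp [(hφ _).1]) ht

theorem flow_smul (hg : LipschitzWith K g)
    (hφ : ∀ x, φ 0 x = x ∧ IsForwardSolution g (fun t => φ t x))
    (hs : ∀ c : ℝ, 0 ≤ c → ∀ x, g (c • x) = c • g x) {c t : ℝ} (hc : 0 ≤ c) (ht : 0 ≤ t)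
    (x : Fin d → ℝ) : φ t (c • x) = c • φ t x := by
  have hsol : IsForwardSolution g (fun t => c • φ t x) := fun r hr => by
    rw [hs c hc]
    exact ((hφ x).2 r hr).const_smul c
  exact (hφ (c • x)).2.eq_of_eq_zero hg hsol (by simp [(hφ _).1]) ht

/-- For a homogeneous vector field with globally asymptotically stable origin, the flow is a
contraction by a factor `1/2` after some time. -/
theorem exists_flow_norm_le_half (hg : LipschitzWith K g)
    (hs : ∀ c : ℝ, 0 ≤ c → ∀ x, g (c • x) = c • g x)
    (hgas : IsGloballyAsymptoticallyStable g {0})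
    (hφ : ∀ x, φ 0 x = x ∧ IsForwardSolution g (fun t => φ t x)) :
    ∃ T : ℝ, 1 ≤ T ∧ ∀ x, ‖φ T x‖ ≤ ‖x‖ / 2 := by
  obtain ⟨δ, hδ, hstab⟩ := hgas.1 1 one_pos
  simp only [Metric.thickening_singleton, mem_ball_zero_iff] at hstab
  -- Homogeneity: stability is applied to `2 • x`.
  have hstab' : ∀ x, ‖x‖ < δ / 2 → ∀ t, 0 ≤ t → ‖φ t x‖ ≤ 1 / 2 := by
    intro x hx t ht
    have h1 := hstab _ (hφ ((2 : ℝ) • x)).2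
      (by simp only [(hφ _).1]; rw [norm_smul, Real.norm_two]; linarith) t ht
    rw [flow_smul hg hφ hs zero_le_two ht, norm_smul, Real.norm_two] at h1
    linarith
  have hattr : ∀ x, ∃ t, 0 ≤ t ∧ ‖φ t x‖ < δ / 2 := by
    intro x
    have h1 := hgas.2 _ (hφ x).2 (δ / 2) (half_pos hδ)
    simp only [Metric.thickening_singleton, mem_ball_zero_iff] at h1
    exact ((eventually_ge_atTop 0).and h1).exists
  choose τ hτ0 hτ using hattr
  have hcont : ∀ x, Continuous (φ (τ x)) := fun x =>
    (LipschitzWith.of_dist_le_mul (K := ⟨Real.exp (K * τ x), (Real.exp_pos _).le⟩)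
      (dist_flow_le hg hφ (hτ0 x))).continuous
  obtain ⟨s, -, hsub⟩ := (isCompact_closedBall (0 : Fin d → ℝ) 1).elim_nhds_subcover
    (fun x => {y | ‖φ (τ x) y‖ < δ / 2})
    (fun x _ => (isOpen_lt (hcont x).norm continuous_const).mem_nhds (hτ x))
  -- The sum exceeds every entry time of the finite cover, and orbits that have entered stay small.
  -- The extra 1 gives `T ≥ 1`, so that steps `s ≤ 1` never exceed `T`.
  have hT : 1 ≤ 1 + ∑ x ∈ s, τ x := by
    have := Finset.sum_nonneg fun x (_ : x ∈ s) => hτ0 x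
    linarith
  have hball : ∀ y, ‖y‖ ≤ 1 → ‖φ (1 + ∑ x ∈ s, τ x) y‖ ≤ 1 / 2 := by
    intro y hy
    obtain ⟨x, hx, hxy⟩ := mem_iUnion₂.1 (hsub (by simpa using hy : y ∈ Metric.closedBall 0 1))
    have hle : τ x ≤ ∑ x ∈ s, τ x := Finset.single_le_sum (fun x _ => hτ0 x) hx
    have h1 : 1 + ∑ x ∈ s, τ x = (1 + ∑ x ∈ s, τ x - τ x) + τ x := by ring
    rw [h1, flow_add hg hφ (by linarith) (hτ0 x)]
    exact hstab' _ hxy _ (by linarith)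
  refine ⟨_, hT, fun x => ?_⟩
  rcases eq_or_ne x 0 with rfl | hx
  · have := flow_smul hg hφ hs le_rfl (zero_le_one.trans hT) (0 : Fin d → ℝ)
    simp only [zero_smul] at this
    simp [this]
  · have hx0 : 0 < ‖x‖ := norm_pos_iff.2 hx
    have h1 := hball (‖x‖⁻¹ • x) (by simp [norm_smul, hx0.ne'])
    rw [flow_smul hg hφ hs (by positivity) (zero_le_one.trans hT), norm_smul, norm_inv, norm_norm,
      inv_mul_le_iff₀ hx0] at h1
    linarith

/-- A homogeneous Lipschitz vector field with globally asymptotically stable origin has a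
(sub)homogeneous Lipschitz Lyapunov function that decays exponentially. -/
theorem exists_lyapunov (hg : LipschitzWith K g)
    (hs : ∀ c : ℝ, 0 ≤ c → ∀ x, g (c • x) = c • g x)
    (hgas : IsGloballyAsymptoticallyStable g {0})
    (hφ : ∀ x, φ 0 x = x ∧ IsForwardSolution g (fun t => φ t x)) :
    ∃ (V : (Fin d → ℝ) → ℝ) (C : NNReal) (l : ℝ), 0 < l ∧ LipschitzWith C V ∧
      (∀ x, ‖x‖ ≤ V x) ∧ (∀ c : ℝ, 0 ≤ c → ∀ x, V (c • x) ≤ c * V x) ∧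
      ∀ s ∈ Icc (0 : ℝ) 1, ∀ x, V (φ s x) ≤ Real.exp (-(l * s)) * V x := by
  obtain ⟨T, hT, hhalf⟩ := exists_flow_norm_le_half hg hs hgas hφ
  have hT0 : 0 < T := one_pos.trans_le hT
  set l := Real.log 2 / T with hl
  have hl0 : 0 < l := div_pos (Real.log_pos one_lt_two) hT0
  have hlT : Real.exp (l * T) = 2 := by
    rw [hl, div_mul_cancel₀ _ hT0.ne', Real.exp_log two_pos]
  have : Nonempty (Icc (0 : ℝ) T) := ⟨⟨0, le_rfl, hT0.le⟩⟩
  set V : (Fin d → ℝ) → ℝ := fun x => ⨆ t : Icc (0 : ℝ) T, Real.exp (l * t) * ‖φ t x‖ with hV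
  have hφ0 : ∀ t, 0 ≤ t → φ t 0 = 0 := by
    intro t ht
    have := flow_smul hg hφ hs le_rfl ht (0 : Fin d → ℝ)
    simpa only [zero_smul] using this
  have hterm : ∀ t ∈ Icc (0 : ℝ) T, ∀ x y, Real.exp (l * t) * ‖φ t x - φ t y‖ ≤
      2 * Real.exp (K * T) * ‖x - y‖ := by
    intro t ht x y
    have h1 := dist_flow_le hg hφ ht.1 x y
    rw [dist_eq_norm, dist_eq_norm] at h1
    have h2 : Real.exp (l * t) ≤ 2 := by
      rw [← hlT]
      exact Real.exp_le_exp.2 (mul_le_mul_of_nonneg_left ht.2 hl0.le)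
    have h3 : Real.exp (K * t) ≤ Real.exp (K * T) :=
      Real.exp_le_exp.2 (mul_le_mul_of_nonneg_left ht.2 K.2)
    calc Real.exp (l * t) * ‖φ t x - φ t y‖ ≤ 2 * (Real.exp (K * T) * ‖x - y‖) := by
          gcongr
          exact h1.trans (by gcongr)
      _ = _ := by ring
  have hbdd : ∀ x, BddAbove (range fun t : Icc (0 : ℝ) T => Real.exp (l * t) * ‖φ t x‖) := by
    intro x
    refine ⟨2 * Real.exp (K * T) * ‖x‖, ?_⟩
    rintro _ ⟨t, rfl⟩
    have := hterm t t.2 x 0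
    rwa [hφ0 _ t.2.1, sub_zero, sub_zero] at this
  have hle : ∀ x, ∀ t ∈ Icc (0 : ℝ) T, Real.exp (l * t) * ‖φ t x‖ ≤ V x := fun x t ht =>
    le_ciSup (hbdd x) (⟨t, ht⟩ : Icc (0 : ℝ) T)
  have hsup : ∀ x B, (∀ t ∈ Icc (0 : ℝ) T, Real.exp (l * t) * ‖φ t x‖ ≤ B) → V x ≤ B :=
    fun x B hB => ciSup_le fun t => hB t t.2
  refine ⟨V, ⟨2 * Real.exp (K * T), by positivity⟩, l, hl0, ?_, ?_, ?_, ?_⟩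
  · refine LipschitzWith.of_le_add_mul _ fun x y => hsup _ _ fun t ht => ?_
    have h1 := hterm t ht x y
    have h2 := hle y t ht
    have h3 : ‖φ t x‖ ≤ ‖φ t y‖ + ‖φ t x - φ t y‖ := by
      simpa using norm_add_le (φ t y) (φ t x - φ t y)
    have h4 : Real.exp (l * t) * ‖φ t x‖ ≤
        Real.exp (l * t) * (‖φ t y‖ + ‖φ t x - φ t y‖) := by gcongr
    rw [dist_eq_norm]
    change _ ≤ V y + 2 * Real.exp (K * T) * ‖x - y‖
    linarith
  · intro x
    simpa [(hφ x).1] using hle x 0 ⟨le_rfl, hT0.le⟩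
  · intro c hc x
    refine hsup _ _ fun t ht => ?_
    rw [flow_smul hg hφ hs hc ht.1, norm_smul, Real.norm_of_nonneg hc, mul_left_comm]
    exact mul_le_mul_of_nonneg_left (hle x t ht) hc
  · intro s hs x
    refine hsup _ _ fun t ht => ?_
    have h1 : Real.exp (l * t) = Real.exp (-(l * s)) * Real.exp (l * (t + s)) := by
      rw [← Real.exp_add]; ring_nf
    rw [h1, mul_assoc, ← flow_add hg hφ ht.1 hs.1]
    gcongr
    rcases le_total (t + s) T with hts | hts
    · exact hle x _ ⟨add_nonneg ht.1 hs.1, hts⟩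
    · have h2 : t + s = T + (t + s - T) := by ring
      have hu : t + s - T ∈ Icc (0 : ℝ) T := ⟨by linarith, by linarith [ht.2, hs.2]⟩
      rw [h2, flow_add hg hφ hT0.le hu.1, mul_add, Real.exp_add, hlT]
      have h3 := hhalf (φ (t + s - T) x)
      have h4 := hle x _ hu
      have h5 := Real.exp_pos (l * (t + s - T))
      nlinarith

/-- A Lyapunov function of the scaling limit decreases at unit speed along the solutions of
`ẋ = h(x)`, as long as it is large. -/
theorem exists_lyapunov_decrease {h : (Fin d → ℝ) → Fin d → ℝ} (hh : LipschitzWith K h)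
    (hK : 1 ≤ K) (hg : LipschitzWith K g)
    (hs : ∀ c : ℝ, 0 ≤ c → ∀ x, g (c • x) = c • g x)
    (happrox : ∀ η : ℝ, 0 < η → ∃ C : ℝ, 0 ≤ C ∧ ∀ x, dist (g x) (h x) ≤ η * ‖x‖ + C)
    (hgas : IsGloballyAsymptoticallyStable g {0}) :
    ∃ (V : (Fin d → ℝ) → ℝ) (C : NNReal) (r : ℝ), 0 < r ∧ LipschitzWith C V ∧
      (∀ x, ‖x‖ ≤ V x) ∧ (∀ c : ℝ, 0 ≤ c → ∀ x, V (c • x) ≤ c * V x) ∧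
      ∀ x, IsForwardSolution h x → ∀ s ∈ Icc (0 : ℝ) 1, r ≤ V (x 0) →
        V (x s) ≤ V (x 0) - s := by
  obtain ⟨φ, hφ⟩ := exists_flow hg
  obtain ⟨V, C, l, hl, hVL, hVn, hVs, hVd⟩ := exists_lyapunov hg hs hgas hφ
  have hφ0 : ∀ t, 0 ≤ t → φ t 0 = 0 := by
    intro t ht
    have := flow_smul hg hφ hs le_rfl ht (0 : Fin d → ℝ)
    simpa only [zero_smul] using this
  -- On `[0, 1]`, `exp (-(l s)) ≤ 1 - m s`, while `q s` turns an error of the vector field into an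
  -- error of `V`. The choice of `η` spends half of the decay on the linear error; the threshold
  -- makes the other half pay for `q A` and leave speed 1.
  set m := l / (1 + l) with hm
  have hm0 : 0 < m := by positivity
  set q : ℝ := (C + 1) * Real.exp K with hq
  have hq0 : 0 < q := by positivity
  set η : ℝ := m / (2 * q * Real.exp K) with hη
  have hη0 : 0 < η := by positivity
  obtain ⟨A, hA0, hA⟩ := happrox η hη0
  refine ⟨V, C, 2 * (q * A + 1) / m, by positivity, hVL, hVn, hVs, fun x hx s hs hr => ?_⟩
  set p := x 0 with hp
  have hε : ∀ t ∈ Icc (0 : ℝ) 1, dist (g (φ t p)) (h (φ t p)) ≤ η * Real.exp K * V p + A := by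
    intro t ht
    have h1 := dist_flow_le hg hφ ht.1 p 0
    rw [hφ0 t ht.1, dist_zero_right, dist_zero_right] at h1
    have h2 : Real.exp (K * t) ≤ Real.exp K :=
      Real.exp_le_exp.2 (mul_le_of_le_one_right K.2 ht.2)
    have h3 : ‖φ t p‖ ≤ Real.exp K * V p := h1.trans (by
      gcongr
      exact hVn p)
    calc _ ≤ η * ‖φ t p‖ + A := hA _
      _ ≤ η * (Real.exp K * V p) + A := by gcongr
      _ = _ := by ring
  have h1 := hx.dist_le_of_approx hh hK (hφ p).2 ((hφ p).1.symm) hε hs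
  have h2 : V (x s) ≤ V (φ s p) + C * dist (x s) (φ s p) := by
    have := hVL.dist_le_mul (x s) (φ s p)
    rw [Real.dist_eq] at this
    linarith [le_abs_self (V (x s) - V (φ s p))]
  have h3 := hVd s hs p
  have hVp : 0 ≤ V p := (norm_nonneg p).trans (hVn p)
  have h4 : Real.exp (-(l * s)) ≤ 1 - m * s := by
    have h5 : Real.exp (-(l * s)) ≤ 1 / (1 + l * s) := by
      rw [Real.exp_neg, ← one_div]
      have := Real.add_one_le_exp (l * s)
      have h0 : 0 ≤ l * s := mul_nonneg hl.le hs.1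
      exact one_div_le_one_div_of_le (by linarith) (by linarith)
    have h0 : 0 ≤ l * s := mul_nonneg hl.le hs.1
    have h6 : 1 / (1 + l * s) = 1 - l * s / (1 + l * s) := by field_simp; ring
    have h7 : m * s ≤ l * s / (1 + l * s) := by
      rw [hm, div_mul_eq_mul_div]
      gcongr
      nlinarith [hs.2]
    linarith
  have h8 : (C : ℝ) * dist (x s) (φ s p) ≤ q * s * (η * Real.exp K * V p + A) := by
    have hnn : 0 ≤ (η * Real.exp K * V p + A) * s * Real.exp K := dist_nonneg.trans h1
    calc (C : ℝ) * dist (x s) (φ s p) ≤ (C + 1) * ((η * Real.exp K * V p + A) * s * Real.exp K) := by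
          gcongr
          linarith
      _ = _ := by rw [hq]; ring
  have h9 : q * (η * Real.exp K) = m / 2 := by
    rw [hη]; field_simp
  have h10 : 2 * (q * A + 1) ≤ V p * m := (div_le_iff₀ hm0).1 hr
  have h11 : Real.exp (-(l * s)) * V p ≤ (1 - m * s) * V p := by gcongr
  have h12 : q * s * (η * Real.exp K * V p + A) = s * (m / 2 * V p + q * A) := by
    rw [← h9]; ring
  have h13 : s * (q * A + 1) ≤ s * (V p * m / 2) :=
    mul_le_mul_of_nonneg_left (by linarith) hs.1
  nlinarith

end Lyapunov

end BorkarMeyn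

namespace BorkarMeyn

/-! ### Functions that decrease above a threshold -/

section Decrease

variable {f : ℝ → ℝ} {r : ℝ}

/-- If a function decreases whenever it is at least `r`, then it stays below any level `r' ≥ r`. -/
theorem le_of_decrease (hf : ContinuousOn f (Ici 0))
    (hdec : ∀ t, 0 ≤ t → r ≤ f t → ∀ s ∈ Icc (0 : ℝ) 1, f (s + t) ≤ f t - s)
    {r' t₀ : ℝ} (hr : r ≤ r') (ht₀ : 0 ≤ t₀) (h0 : f t₀ ≤ r') {t : ℝ} (ht : t₀ ≤ t) :
    f t ≤ r' := by
  have hcl : IsClosed ({t | f t ≤ r'} ∩ Icc t₀ t) := by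
    have := (hf.mono fun s hs => ht₀.trans hs.1 : ContinuousOn f (Icc t₀ t)).preimage_isClosed_of_isClosed
      isClosed_Icc (isClosed_Iic (a := r'))
    rwa [inter_comm] at this
  -- Continuous induction: below `r'` continuity extends the bound to the right, at `r'` the
  -- decrease does.
  refine hcl.Icc_subset_of_forall_mem_nhdsWithin h0 (fun x hx => ?_) ⟨ht, le_rfl⟩
  have hx0 : 0 ≤ x := ht₀.trans hx.2.1
  have hxr : f x ≤ r' := hx.1
  rcases hxr.lt_or_eq with hlt | heq
  · have hc : ContinuousWithinAt f (Ioi x) x :=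
      (hf x hx0).mono fun y hy => hx0.trans (le_of_lt hy)
    filter_upwards [hc.eventually (gt_mem_nhds hlt)] with y hy using le_of_lt hy
  · filter_upwards [Ioc_mem_nhdsGT (lt_add_one x)] with y hy
    have := hdec x hx0 (hr.trans heq.ge) (y - x) ⟨by linarith [hy.1], by linarith [hy.2]⟩
    rw [sub_add_cancel] at this
    change f y ≤ r'
    linarith [hy.1]

/-- Unit time steps above `r` each cost at least 1, which nonnegativity allows only finitely often;
afterwards the level is never exceeded. -/
theorem eventually_le_of_decrease (hf : ContinuousOn f (Ici 0)) (hpos : ∀ t, 0 ≤ f t)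
    (hdec : ∀ t, 0 ≤ t → r ≤ f t → ∀ s ∈ Icc (0 : ℝ) 1, f (s + t) ≤ f t - s) :
    ∀ᶠ t in atTop, f t ≤ r := by
  have hex : ∃ t₀, 0 ≤ t₀ ∧ f t₀ ≤ r := by
    by_contra! hcon
    have hn : ∀ n : ℕ, f n ≤ f 0 - n := by
      intro n
      induction n with
      | zero => simp
      | succ n ih =>
        have := hdec n (Nat.cast_nonneg n) (hcon n (Nat.cast_nonneg n)).le 1 ⟨zero_le_one, le_rfl⟩
        push_cast
        rw [add_comm]
        linarith
    obtain ⟨n, hn'⟩ := exists_nat_gt (f 0)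
    linarith [hn n, hpos n]
  obtain ⟨t₀, ht₀, h0⟩ := hex
  filter_upwards [eventually_ge_atTop t₀] with t ht
  exact le_of_decrease hf hdec le_rfl ht₀ h0 ht

end Decrease

/-! ### Sublevel sets: stability and equilibria -/

section Sublevel

variable {d : ℕ} {h : (Fin d → ℝ) → Fin d → ℝ} {V : (Fin d → ℝ) → ℝ} {C K : NNReal} {r : ℝ}

theorem isCompact_sublevel (hVc : Continuous V) (hVn : ∀ x, ‖x‖ ≤ V x) : IsCompact {x | V x ≤ r} := by
  refine (isCompact_closedBall (0 : Fin d → ℝ) r).of_isClosed_subset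
    (isClosed_le hVc continuous_const) fun x hx => ?_
  simpa using (hVn x).trans hx

/-- Subhomogeneity makes the set star-shaped about the origin. -/
theorem isConnected_sublevel (hVs : ∀ c : ℝ, 0 ≤ c → ∀ x, V (c • x) ≤ c * V x) (hr : 0 ≤ r) :
    IsConnected {x | V x ≤ r} := by
  have h0 : V 0 ≤ 0 := by simpa using hVs 0 le_rfl 0
  have hstar : StarConvex ℝ 0 {x | V x ≤ r} := by
    refine starConvex_zero_iff.2 fun x hx a ha ha1 => ?_
    have hx' : V x ≤ r := hx
    have h1 := hVs a ha x
    change V (a • x) ≤ r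
    nlinarith
  exact (hstar.isPathConnected (h0.trans hr)).isConnected

/-- Sublevel sets of the Lyapunov function are globally asymptotically stable. -/
theorem isGloballyAsymptoticallyStable_sublevel (hr : 0 < r) (hVL : LipschitzWith C V)
    (hVn : ∀ x, ‖x‖ ≤ V x) (hVs : ∀ c : ℝ, 0 ≤ c → ∀ x, V (c • x) ≤ c * V x)
    (hinv : ∀ x, IsForwardSolution h x → ∀ r', r ≤ r' → V (x 0) ≤ r' → ∀ t, 0 ≤ t → V (x t) ≤ r')
    (hattr : ∀ x, IsForwardSolution h x → ∀ᶠ t in atTop, V (x t) ≤ r) :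
    IsGloballyAsymptoticallyStable h {x | V x ≤ r} := by
  constructor
  · intro ε hε
    -- This `δ` keeps the start, hence the whole orbit, below level `r + ε / 2`. Scaling by `c = r /
    -- (r + ε / 2)` returns to level `r` and moves a point by at most `ε / 2`.
    refine ⟨ε / (2 * (C + 1)), by positivity, fun x hx hx0 t ht => ?_⟩
    obtain ⟨z, hz, hxz⟩ := Metric.mem_thickening_iff.1 hx0
    have hz' : V z ≤ r := hz
    have h1 : V (x 0) ≤ r + ε / 2 := by
      have h2 := hVL.dist_le_mul (x 0) z
      rw [Real.dist_eq] at h2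
      have h3 : (C : ℝ) * dist (x 0) z ≤ (C + 1) * (ε / (2 * (C + 1))) := by
        gcongr
        linarith
      have h4 : ((C : ℝ) + 1) * (ε / (2 * (C + 1))) = ε / 2 := by field_simp
      linarith [le_abs_self (V (x 0) - V z)]
    have h5 := hinv x hx _ (by linarith) h1 t ht
    set c := r / (r + ε / 2) with hc
    have hrε : 0 < r + ε / 2 := by positivity
    have hc0 : 0 ≤ c := by positivity
    have hcr : c * (r + ε / 2) = r := div_mul_cancel₀ _ hrε.ne'
    have hc1 : c ≤ 1 := by
      rw [hc, div_le_one hrε]; linarith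
    refine Metric.mem_thickening_iff.2 ⟨c • x t, ?_, ?_⟩
    · calc V (c • x t) ≤ c * V (x t) := hVs c hc0 _
        _ ≤ c * (r + ε / 2) := by gcongr
        _ = r := hcr
    · have h6 : x t - c • x t = (1 - c) • x t := by rw [sub_smul, one_smul]
      rw [dist_eq_norm, h6, norm_smul, Real.norm_of_nonneg (by linarith)]
      have h7 : (1 - c) * ‖x t‖ ≤ (1 - c) * (r + ε / 2) := by
        refine mul_le_mul_of_nonneg_left ((hVn _).trans h5) ?_
        linarith
      linarith
  · intro x hx ε hε
    filter_upwards [hattr x hx] with t ht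
    exact Metric.self_subset_thickening hε _ ht

/-- **Brouwer's fixed point theorem** for Lipschitz self-maps of the star-shaped sublevel sets. -/
theorem exists_fixedPoint_sublevel (hr : 0 < r) (hVL : LipschitzWith C V)
    (hVn : ∀ x, ‖x‖ ≤ V x) (hVs : ∀ c : ℝ, 0 ≤ c → ∀ x, V (c • x) ≤ c * V x)
    {f : (Fin d → ℝ) → Fin d → ℝ} (hf : LipschitzWith K f)
    (hmaps : ∀ x, V x ≤ r → V (f x) ≤ r) : ∃ x, V x ≤ r ∧ f x = x := by
  -- With `v = V x / r`, `v (2 - v) ≤ 1` shows that `χ x • x` always lies in the sublevel set; `χ`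
  -- is 1 on that set and 0 once `v ≥ 2`.
  set χ : (Fin d → ℝ) → ℝ := fun x => max 0 (min 1 (2 - V x / r)) with hχ
  have hχ0 : ∀ x, 0 ≤ χ x := fun x => le_max_left _ _
  have hχ1 : ∀ x, χ x ≤ 1 := fun x => max_le zero_le_one (min_le_left _ _)
  have hχB : ∀ x, |χ x| ≤ 1 := fun x => by rw [abs_of_nonneg (hχ0 x)]; exact hχ1 x
  have hχR : ∀ x, 2 * r ≤ ‖x‖ → χ x = 0 := by
    intro x hx
    have h1 : 2 ≤ V x / r := (le_div_iff₀ hr).2 (hx.trans (hVn x))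
    exact max_eq_left ((min_le_right _ _).trans (by linarith))
  have hχV : ∀ x, V (χ x • x) ≤ r := by
    intro x
    refine (hVs _ (hχ0 x) x).trans ?_
    have hv0 : 0 ≤ V x / r := div_nonneg ((norm_nonneg x).trans (hVn x)) hr.le
    have hv : χ x * (V x / r) ≤ 1 := by
      rcases le_total 2 (V x / r) with h2 | h2
      · have : χ x = 0 := max_eq_left ((min_le_right _ _).trans (by linarith))
        rw [this]; simp
      · have : χ x ≤ 2 - V x / r := max_le (by linarith) (min_le_right _ _)
        nlinarith [sq_nonneg (V x / r - 1)]
    rwa [← mul_div_assoc, div_le_one hr] at hv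
  have hχL : ∃ D, LipschitzWith D χ := by
    refine ⟨C / ⟨r, hr.le⟩, LipschitzWith.of_dist_le_mul fun x y => ?_⟩
    have h1 : |χ x - χ y| ≤ |V x / r - V y / r| := by
      have h2 := abs_max_sub_max_le_abs (min (2 - V x / r) 1) (min (2 - V y / r) 1) 0
      have h3 := abs_inf_sub_inf_le_abs (2 - V x / r) (2 - V y / r) 1
      rw [sub_sub_sub_cancel_left, abs_sub_comm (V y / r)] at h3
      simp only [hχ, max_comm (0 : ℝ), min_comm (1 : ℝ)]
      exact h2.trans h3
    have h4 := hVL.dist_le_mul x y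
    rw [Real.dist_eq] at h4 ⊢
    refine h1.trans ?_
    rw [← sub_div, abs_div, abs_of_pos hr]
    change _ ≤ (C : ℝ) / r * dist x y
    rw [div_mul_eq_mul_div]
    gcongr
  obtain ⟨D, hD⟩ := hχL
  obtain ⟨D₁, hD₁⟩ := exists_lipschitzWith_smul hD LipschitzWith.id hχB hχR
  obtain ⟨D₂, hD₂⟩ := exists_lipschitzWith_smul hD (hf.comp hD₁) hχB hχR
  obtain ⟨x, hx⟩ := exists_zero_of_eq_id (LipschitzWith.id.sub hD₂) (R := 2 * r)
    (fun x hx => by simp [hχR x hx])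
  have hx' : x = χ x • f (χ x • x) := by simpa [sub_eq_zero] using hx
  -- The zero is a scaled-down value of `f` on the sublevel set, so it lies in that set, where the
  -- cut-off is inactive.
  have hVx : V x ≤ r := by
    rw [hx']
    have h1 := hmaps _ (hχV x)
    refine (hVs _ (hχ0 x) _).trans ?_
    have h2 : χ x * V (f (χ x • x)) ≤ χ x * r := mul_le_mul_of_nonneg_left h1 (hχ0 x)
    nlinarith [hχ1 x]
  have hχx : χ x = 1 := by
    have h1 : V x / r ≤ 1 := (div_le_one hr).2 hVx
    simp only [hχ]
    rw [min_eq_left (by linarith), max_eq_right zero_le_one]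
  rw [hχx, one_smul, one_smul] at hx'
  exact ⟨x, hVx, hx'.symm⟩

/-- A Lipschitz vector field has an equilibrium in a forward invariant sublevel set. -/
theorem exists_equilibrium_sublevel (hr : 0 < r) (hVL : LipschitzWith C V)
    (hVn : ∀ x, ‖x‖ ≤ V x) (hVs : ∀ c : ℝ, 0 ≤ c → ∀ x, V (c • x) ≤ c * V x)
    (hh : LipschitzWith K h)
    (hinv : ∀ x, IsForwardSolution h x → V (x 0) ≤ r → ∀ t, 0 ≤ t → V (x t) ≤ r) :
    ∃ x, h x = 0 := by
  obtain ⟨φ, hφ⟩ := exists_flow hh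
  have hM : IsCompact {x | V x ≤ r} := isCompact_sublevel hVL.continuous hVn
  have hMne : {x | V x ≤ r}.Nonempty :=
    ⟨0, (by simpa using hVs 0 le_rfl 0 : V 0 ≤ 0).trans hr.le⟩
  obtain ⟨A, hA⟩ := hM.exists_bound_of_continuousOn hh.continuous.continuousOn
  -- The minimiser of `‖h‖` does not depend on `t`, so no convergent subsequence of fixed points is
  -- needed.
  obtain ⟨p, -, hp⟩ := hM.exists_isMinOn hMne hh.continuous.norm.continuousOn
  have hbound : ∀ t, 0 < t → ‖h p‖ ≤ K * A * t := by
    intro t ht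
    have hL : LipschitzWith ⟨Real.exp (K * t), (Real.exp_pos _).le⟩ (φ t) :=
      LipschitzWith.of_dist_le_mul (dist_flow_le hh hφ ht.le)
    -- At a fixed point of the time-`t` map the short-time expansion reads `t ‖h x‖ ≤ K A t²`.
    obtain ⟨x, hxM, hx⟩ := exists_fixedPoint_sublevel hr hVL hVn hVs hL (fun x hx =>
      hinv _ (hφ x).2 (by simpa only [(hφ x).1] using hx) t ht.le)
    have h1 := (hφ x).2.norm_sub_sub_smul_le hh (C := A) (fun s hs => hA _
      (hinv _ (hφ x).2 (by simpa only [(hφ x).1] using hxM) s hs)) ht.le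
    simp only [(hφ x).1, hx, sub_self, zero_sub, norm_neg, norm_smul] at h1
    rw [Real.norm_of_nonneg ht.le, mul_comm] at h1
    exact (hp hxM : ‖h p‖ ≤ ‖h x‖).trans (le_of_mul_le_mul_right h1 ht)
  refine ⟨p, norm_le_zero_iff.1 ?_⟩
  have hlim : Tendsto (fun t : ℝ => K * A * t) (𝓝[>] 0) (𝓝 0) := by
    have : Tendsto (fun t : ℝ => K * A * t) (𝓝 0) (𝓝 (K * A * 0)) :=
      (continuous_const.mul continuous_id).tendsto 0
    rw [mul_zero] at this
    exact this.mono_left nhdsWithin_le_nhds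
  refine ge_of_tendsto hlim ?_
  filter_upwards [self_mem_nhdsWithin] with t ht using hbound t ht

end Sublevel

end BorkarMeyn

/-! ### Conclusion -/

theorem mainTheorem10 (d : ℕ) (h : (Fin d → ℝ) → Fin d → ℝ)
    (hh : BorkarMeyn.Assumption h) :
    (BorkarMeyn.equilibriumSet h).Nonempty ∧
      IsCompact (BorkarMeyn.equilibriumSet h) ∧
      ∃ M : Set (Fin d → ℝ),
        IsCompact M ∧ IsConnected M ∧ BorkarMeyn.IsGloballyAsymptoticallyStable h M ∧
          BorkarMeyn.equilibriumSet h ⊆ M := by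
  obtain ⟨⟨L, hL, hLip⟩, g, hlim, ⟨hg0, hgas⟩, -⟩ := hh
  -- Enlarging `L` by 1 secures the bound `1 ≤ K` required by the Grönwall estimate.
  have hK : LipschitzWith (⟨L, hL⟩ + 1) h := LipschitzWith.of_dist_le_mul fun x y => by
    rw [dist_eq_norm, dist_eq_norm]
    refine (hLip x y).trans ?_
    change L * ‖x - y‖ ≤ (L + 1) * ‖x - y‖
    gcongr
    linarith
  have hptw : ∀ x, Tendsto (fun c : ℝ => c⁻¹ • h (c • x)) atTop (𝓝 (g x)) := fun x =>
    (hlim {x} isCompact_singleton).tendsto_at (mem_singleton x)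
  have hgL := BorkarMeyn.lipschitzWith_scaling_limit hK hptw
  have hgs : ∀ c : ℝ, 0 ≤ c → ∀ x, g (c • x) = c • g x := fun c hc x =>
    BorkarMeyn.scaling_limit_smul hptw hg0 hc x
  obtain ⟨V, C, r, hr, hVL, hVn, hVs, hdec⟩ := BorkarMeyn.exists_lyapunov_decrease hK
    le_add_self hgL hgs
    (fun η hη => BorkarMeyn.exists_dist_scaling_limit_le hK hlim hgL hgs hη) hgas
  have hdec' : ∀ x, BorkarMeyn.IsForwardSolution h x → ∀ t, 0 ≤ t → r ≤ V (x t) →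
      ∀ s ∈ Icc (0 : ℝ) 1, V (x (s + t)) ≤ V (x t) - s := fun x hx t ht hrt s hs => by
    have := hdec _ (hx.shift ht) s hs
    simp only [zero_add] at this
    exact this hrt
  have hcont : ∀ x, BorkarMeyn.IsForwardSolution h x → ContinuousOn (fun t => V (x t)) (Ici 0) :=
    fun x hx => hVL.continuous.comp_continuousOn hx.continuousOn
  have hinv : ∀ x, BorkarMeyn.IsForwardSolution h x → ∀ r', r ≤ r' → V (x 0) ≤ r' →
      ∀ t, 0 ≤ t → V (x t) ≤ r' := fun x hx r' hr' h0 t ht =>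
    BorkarMeyn.le_of_decrease (f := fun t => V (x t)) (hcont x hx) (hdec' x hx) hr' le_rfl h0 ht
  have hattr : ∀ x, BorkarMeyn.IsForwardSolution h x → ∀ᶠ t in atTop, V (x t) ≤ r := fun x hx =>
    BorkarMeyn.eventually_le_of_decrease (hcont x hx)
      (fun t => (norm_nonneg _).trans (hVn _)) (hdec' x hx)
  -- A constant solution eventually satisfies `V ≤ r`, hence always does.
  have hsub : BorkarMeyn.equilibriumSet h ⊆ {x | V x ≤ r} := fun p hp =>
    (hattr _ (BorkarMeyn.isForwardSolution_const hp)).exists.choose_spec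
  have hM : IsCompact {x | V x ≤ r} := BorkarMeyn.isCompact_sublevel hVL.continuous hVn
  exact ⟨BorkarMeyn.exists_equilibrium_sublevel hr hVL hVn hVs hK
      (fun x hx h0 => hinv x hx r le_rfl h0),
    hM.of_isClosed_subset (isClosed_eq hK.continuous continuous_const) hsub,
    _, hM, BorkarMeyn.isConnected_sublevel hVs hr.le,
    BorkarMeyn.isGloballyAsymptoticallyStable_sublevel hr hVL hVn hVs hinv hattr, hsub⟩
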